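/- Let $n,m\ge 0$, $C_-,C_+\in\mathbb{C}^{m\times n}$ and $\Omega_-,\Omega_+\in\mathbb{C}^{n\times n}$. Write $X^\#$ for the entrywise conjugate and $X^\dagger$ for the conjugate transpose of a matrix $X$, $\Delta(U,V)=\begin{bmatrix}U&V\\V^\#&U^\#\end{bmatrix}$, $J_k=\mathrm{diag}(I_k,-I_k)$, and $X^\flat=J_rX^\dagger J_k$ for $X\in\mathbb{C}^{2k\times 2r}$. Suppose that $\Omega=\Delta(\Omega_-,\Omega_+)$ is Hermitian. Consider the linear quantum system (with identity scattering matrix) $$\dot x=\mathcal{A}x+\mathcal{B}u,\qquad y=\mathcal{C}x+\mathcal{D}u,$$ $$\mathcal{D}=\Delta(I,0),\quad \mathcal{C}=\Delta(C_-,C_+),\quad \mathcal{B}=-\mathcal{C}^\flat\mathcal{D},\quad \mathcal{A}=-\imath J_n\Omega-\tfrac12\mathcal{C}^\flat\mathcal{C},$$ with $x(t)\in\mathbb{C}^{2n}$, $u(t),y(t)\in\mathbb{C}^{2m}$. Let $R=\sum_{k\ge0}\mathrm{Im}(\mathcal{A}^k\mathcal{B})$ be its controllable subspace and $N=\bigcap_{k\ge0}\ker(\mathcal{C}\mathcal{A}^k)$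 its unobservable subspace, and let $\mathcal{A}_o$ be the map induced by $\mathcal{A}$ on $\mathbb{C}^{2n}/N$ (the observable part). Assume that, in the Kalman decomposition of the system, the eigenvalues of the system matrices of the "$h$" subsystem (the controllable and unobservable part together with the uncontrollable and observable part) and of the uncontrollable and unobservable subsystem are purely imaginary (possibly zero); that is, the maps induced by $\mathcal{A}$ on $R\cap N$, on $\mathbb{C}^{2n}/(R+N)$ and on $N/(R\cap N)$ have only purely imaginary eigenvalues. Then the system is asymptotically strongly left invertible, i.e. for every initial condition $x(0)$ and every input $u$, $$y(t)=0\ \text{ for all } t>0\quad\Longrightarrow\quad u(t)\to0\ \text{ as } t\to\infty,$$ if and only if all eigenvalues of $\mathcal{A}_o$ lie in the open right half plane $\{s\in\mathbb{C}:\operatorname{Re}s>0\}$. -/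

import Mathlib

open Filter Topology

/-! ## Finite-dimensional linear time-invariant systems -/

/-- A system `x' = A x + B u`, `y = C x + D u` with state, input and output coordinates
indexed by `ι`, `κ` and `ο`. -/
structure FDLTI (ι κ ο : Type) where
  A : Matrix ι ι ℂ
  B : Matrix ι κ ℂ
  C : Matrix ο ι ℂ
  D : Matrix ο κ ℂ

namespace FDLTI

variable {ι κ ο : Type} [Fintype ι] [DecidableEq ι] [Fintype κ]

/-- `x` is the state trajectory on `[0, ∞)` with initial condition `x₀` and input `u`.
The input is any locally integrable signal, and `x' = A x + B u` is meant in the sense of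
Carathéodory (integrated form), so that inputs with jumps are allowed. -/
structure IsTrajectory (G : FDLTI ι κ ο) (x₀ : ι → ℂ) (u : ℝ → κ → ℂ) (x : ℝ → ι → ℂ) :
    Prop where
  input : ∀ t : ℝ, 0 ≤ t → IntervalIntegrable u MeasureTheory.volume 0 t
  cont : ContinuousOn x (Set.Ici 0)
  init : x 0 = x₀
  eq : ∀ t : ℝ, 0 ≤ t →
    x t = x₀ + ∫ s in (0 : ℝ)..t, (G.A.mulVec (x s) + G.B.mulVec (u s))

/-- The output `y(t) = C x(t) + D u(t)`. -/
def output (G : FDLTI ι κ ο) (u : ℝ → κ → ℂ) (x : ℝ → ι → ℂ) (t : ℝ) : ο → ℂ :=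
  G.C.mulVec (x t) + G.D.mulVec (u t)

/-- Asymptotic strong left invertibility: for any initial condition, `y(t) = 0` for all `t > 0`
implies `u(t) → 0` as `t → ∞`. -/
def IsAsymptoticallyStronglyLeftInvertible (G : FDLTI ι κ ο) : Prop :=
  ∀ (x₀ : ι → ℂ) (u : ℝ → κ → ℂ) (x : ℝ → ι → ℂ), G.IsTrajectory x₀ u x →
    (∀ t : ℝ, 0 < t → G.output u x t = 0) → Tendsto u atTop (𝓝 0)

/-! ### Controllable and unobservable subspaces -/

/-- The system matrix as an endomorphism of the state space. -/
noncomputable def stateMap (G : FDLTI ι κ ο) : Module.End ℂ (ι → ℂ) := Matrix.mulVecLin G.A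

/-- The controllable subspace, i.e. the range of `[B, AB, A²B, …]`. -/
noncomputable def controllable (G : FDLTI ι κ ο) : Submodule ℂ (ι → ℂ) :=
  ⨆ k : ℕ, LinearMap.range (Matrix.mulVecLin (G.A ^ k * G.B))

/-- The unobservable subspace, i.e. the kernel of the matrix with block rows
`C, CA, CA², …`. -/
noncomputable def unobservable (G : FDLTI ι κ ο) : Submodule ℂ (ι → ℂ) :=
  ⨅ k : ℕ, LinearMap.ker (Matrix.mulVecLin (G.C * G.A ^ k))

theorem controllable_invariant (G : FDLTI ι κ ο) :
    G.controllable ≤ G.controllable.comap G.stateMap := by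
  refine iSup_le fun k => ?_
  rintro _ ⟨v, rfl⟩
  refine Submodule.mem_iSup_of_mem (k + 1) ⟨v, ?_⟩
  simp [stateMap, pow_succ', Matrix.mul_assoc]

theorem unobservable_invariant (G : FDLTI ι κ ο) :
    G.unobservable ≤ G.unobservable.comap G.stateMap := by
  intro v hv
  simp only [unobservable, Submodule.mem_comap, Submodule.mem_iInf, LinearMap.mem_ker,
    Matrix.mulVecLin_apply, stateMap] at hv ⊢
  intro k
  have h := hv (k + 1)
  rw [pow_succ, ← Matrix.mul_assoc] at h
  rw [Matrix.mulVec_mulVec]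
  exact h

/-! ### The diagonal blocks of the Kalman decomposition

Let `R` be the controllable and `N` the unobservable subspace of the state space `V`. In any basis
of `V` adapted to `R` and `N`, the diagonal blocks of `A` are matrices of the maps which `A` induces
on the following subquotients:

* `R ∩ N`       : controllable and unobservable,
* `N / (R ∩ N)` : uncontrollable and unobservable,
* `V / (R + N)` : uncontrollable and observable,
* `V / N`       : the observable part (both the controllable and the uncontrollable one).
-/

/-- The system matrix of the observable part. -/
noncomputable def observablePart (G : FDLTI ι κ ο) :
    Module.End ℂ ((ι → ℂ) ⧸ G.unobservable) :=
  G.unobservable.mapQ G.unobservable G.stateMap G.unobservable_invariant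

/-- The system matrix of the unobservable part. -/
noncomputable def unobservablePart (G : FDLTI ι κ ο) : Module.End ℂ G.unobservable :=
  G.stateMap.restrict fun _ hv => G.unobservable_invariant hv

/-- The system matrix of the controllable and unobservable subsystem. -/
noncomputable def controllableUnobservablePart (G : FDLTI ι κ ο) :
    Module.End ℂ ↥(G.controllable ⊓ G.unobservable) :=
  G.stateMap.restrict fun _ hv => ⟨G.controllable_invariant hv.1, G.unobservable_invariant hv.2⟩

/-- The system matrix of the uncontrollable and unobservable subsystem. -/
noncomputable def uncontrollableUnobservablePart (G : FDLTI ι κ ο) :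
    Module.End ℂ (G.unobservable ⧸ G.controllable.submoduleOf G.unobservable) :=
  (G.controllable.submoduleOf G.unobservable).mapQ (G.controllable.submoduleOf G.unobservable)
    G.unobservablePart fun _ hv => G.controllable_invariant hv

/-- The system matrix of the uncontrollable and observable subsystem. -/
noncomputable def uncontrollableObservablePart (G : FDLTI ι κ ο) :
    Module.End ℂ ((ι → ℂ) ⧸ (G.controllable ⊔ G.unobservable)) :=
  (G.controllable ⊔ G.unobservable).mapQ (G.controllable ⊔ G.unobservable) G.stateMap
    (sup_le (G.controllable_invariant.trans (Submodule.comap_mono le_sup_left))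
      (G.unobservable_invariant.trans (Submodule.comap_mono le_sup_right)))

end FDLTI

/-! ## Linear quantum systems -/

namespace LinearQuantum

/-- All eigenvalues of `f` are purely imaginary (zero included). -/
def HasImaginarySpectrum {V : Type} [AddCommGroup V] [Module ℂ V] (f : Module.End ℂ V) : Prop :=
  ∀ s : ℂ, Module.End.HasEigenvalue f s → s.re = 0

/-- The doubled-up matrix `Δ(U, V) = [U, V; V^#, U^#]`, where `#` conjugates each entry. -/
def doubledUp {k r : ℕ} (U V : Matrix (Fin k) (Fin r) ℂ) :
    Matrix (Fin k ⊕ Fin k) (Fin r ⊕ Fin r) ℂ :=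
  Matrix.fromBlocks U V (V.map star) (U.map star)

/-- `J_k = diag(I_k, -I_k)`. -/
def J (k : ℕ) : Matrix (Fin k ⊕ Fin k) (Fin k ⊕ Fin k) ℂ :=
  Matrix.fromBlocks 1 0 0 (-1)

/-- The adjoint `X^♭ = J_r X† J_k` of a `2k × 2r` matrix `X`. -/
def flatAdjoint {k r : ℕ} (X : Matrix (Fin k ⊕ Fin k) (Fin r ⊕ Fin r) ℂ) :
    Matrix (Fin r ⊕ Fin r) (Fin k ⊕ Fin k) ℂ :=
  J r * X.conjTranspose * J k

end LinearQuantum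

open LinearQuantum in
/-- A linear quantum system of `n` harmonic oscillators coupled to `m` boson fields, with
identity scattering, coupling operator `L = [C₋ C₊] ă` and Hamiltonian `H = ½ ă† Ω ă`,
where `Ω = Δ(Ω₋, Ω₊)` is Hermitian. -/
structure LinearQuantumSystem (n m : ℕ) where
  Cminus : Matrix (Fin m) (Fin n) ℂ
  Cplus : Matrix (Fin m) (Fin n) ℂ
  Ωminus : Matrix (Fin n) (Fin n) ℂ
  Ωplus : Matrix (Fin n) (Fin n) ℂ
  hermitian : (doubledUp Ωminus Ωplus).IsHermitian

namespace LinearQuantumSystem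

open LinearQuantum

variable {n m : ℕ}

/-- `Ω = Δ(Ω₋, Ω₊)`. -/
def Ω (Q : LinearQuantumSystem n m) : Matrix (Fin n ⊕ Fin n) (Fin n ⊕ Fin n) ℂ :=
  doubledUp Q.Ωminus Q.Ωplus

/-- `𝒞 = Δ(C₋, C₊)`. -/
def matC (Q : LinearQuantumSystem n m) : Matrix (Fin m ⊕ Fin m) (Fin n ⊕ Fin n) ℂ :=
  doubledUp Q.Cminus Q.Cplus

/-- `𝒟 = Δ(S, 0)` with `S = I`. -/
def matD (_Q : LinearQuantumSystem n m) : Matrix (Fin m ⊕ Fin m) (Fin m ⊕ Fin m) ℂ :=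
  doubledUp 1 0

/-- `ℬ = -𝒞^♭ 𝒟`. -/
def matB (Q : LinearQuantumSystem n m) : Matrix (Fin n ⊕ Fin n) (Fin m ⊕ Fin m) ℂ :=
  -(flatAdjoint Q.matC * Q.matD)

/-- `𝒜 = -i J_n Ω - ½ 𝒞^♭ 𝒞`. -/
noncomputable def matA (Q : LinearQuantumSystem n m) :
    Matrix (Fin n ⊕ Fin n) (Fin n ⊕ Fin n) ℂ :=
  -(Complex.I • (J n * Q.Ω)) - (1 / 2 : ℂ) • (flatAdjoint Q.matC * Q.matC)

/-- The linear system governing the annihilation-creation operators. -/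
noncomputable def toFDLTI (Q : LinearQuantumSystem n m) :
    FDLTI (Fin n ⊕ Fin n) (Fin m ⊕ Fin m) (Fin m ⊕ Fin m) where
  A := Q.matA
  B := Q.matB
  C := Q.matC
  D := Q.matD

/-- The poles (eigenvalues of the system matrix) of the subsystem `h` and of the uncontrollable and
unobservable subsystem are purely imaginary. The subsystem `h` consists of the controllable and
unobservable and of the uncontrollable and observable coordinates; its system matrix is block
triangular, with these two diagonal blocks. -/
structure ImaginaryHAndDarkPoles (Q : LinearQuantumSystem n m) : Prop where
  h_controllable_unobservable :
    HasImaginarySpectrum Q.toFDLTI.controllableUnobservablePart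
  h_uncontrollable_observable :
    HasImaginarySpectrum Q.toFDLTI.uncontrollableObservablePart
  uncontrollable_unobservable :
    HasImaginarySpectrum Q.toFDLTI.uncontrollableUnobservablePart

end LinearQuantumSystem

/-! ### Characteristic polynomials and reflection in the imaginary axis. -/

section Spectrum

open Polynomial

/-! Since `D = 1`, zero output forces `u = -C x`, so the state evolves with `Z = A - B C`. Both `A`
and `Z` preserve the unobservable space `N`, and `C` vanishes there. Left invertibility therefore
means that the map induced by `Z` on the quotient by `N` has spectrum in the open left half plane
(`isAsymptoticallyStronglyLeftInvertible_iff`): an eigenvector of the quotient gives an input of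
size `‖exp (s t)‖`, and Cayley–Hamilton on the quotient gives decay.

The quantum structure yields `Z = -A^♭` (`zeroOutputMatrix_eq`), so the spectrum of `Z` is that of
`A` under `s ↦ -conj s`, with multiplicity. On `N` the two maps agree and have imaginary spectrum,
so this common factor of the characteristic polynomials is its own reflection up to sign. Cancelling
it leaves the reflection between the quotients (`hasEigenvalue_zeroOutputObservablePart_iff`). -/

theorem LinearMap.charpoly_eq_charpoly_restrict_mul_charpoly_mapQ {K V : Type*} [Field K]
    [Infinite K] [AddCommGroup V] [Module K V] [FiniteDimensional K V] (f : V →ₗ[K] V)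
    (W : Submodule K V) (hW : W ≤ W.comap f) :
    f.charpoly = (f.restrict hW).charpoly * (W.mapQ W f hW).charpoly := by
  refine Polynomial.funext fun t => ?_
  have h : W ≤ W.comap (algebraMap K (V →ₗ[K] V) t - f) := fun v hv =>
    W.sub_mem (W.smul_mem t hv) (hW hv)
  rw [Polynomial.eval_mul, LinearMap.eval_charpoly, LinearMap.eval_charpoly,
    LinearMap.eval_charpoly, LinearMap.det_eq_det_mul_det W _ h]
  congr 2
  ext v
  rfl

/-- The polynomial `conj (p (-conj s))` in `s`. -/
noncomputable def Polynomial.imaginaryReflection : ℂ[X] →+* ℂ[X] :=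
  (Polynomial.compRingHom (-X)).comp (Polynomial.mapRingHom (starRingEnd ℂ))

theorem Polynomial.eval_imaginaryReflection (p : ℂ[X]) (s : ℂ) :
    (imaginaryReflection p).eval s = star (p.eval (-star s)) := by
  have h := Polynomial.eval_map_apply (f := starRingEnd ℂ) (p := p) (-star s)
  simp only [imaginaryReflection, RingHom.comp_apply, Polynomial.coe_compRingHom,
    Polynomial.coe_mapRingHom, Polynomial.eval_comp, Polynomial.eval_neg, Polynomial.eval_X]
  simpa using h

/-- A monic polynomial with purely imaginary roots agrees, up to sign, with its reflection. -/
theorem Polynomial.imaginaryReflection_of_roots_imaginary {p : ℂ[X]} (hp : p.Monic)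
    (h : ∀ s, p.IsRoot s → s.re = 0) :
    imaginaryReflection p = (-1) ^ p.natDegree * p := by
  have hroots : ∀ S : Multiset ℂ, (∀ s ∈ S, s.re = 0) →
      imaginaryReflection ((S.map fun a => X - C a).prod) =
        (-1) ^ S.card * (S.map fun a => X - C a).prod := by
    intro S
    induction S using Multiset.induction_on with
    | empty => simp
    | cons a S ih =>
      intro hS
      have ha : imaginaryReflection (X - C a) = (-1) * (X - C a) := by
        refine Polynomial.funext fun t => ?_
        have hs : star a = -a := by
          apply Complex.ext <;> simp [hS a (Multiset.mem_cons_self _ _)]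
        rw [eval_imaginaryReflection]
        simp only [eval_sub, eval_X, eval_C, eval_mul, eval_neg, eval_one, star_sub, star_neg,
          star_star, hs]
        ring
      rw [Multiset.map_cons, Multiset.prod_cons, map_mul, ha,
        ih fun s hs => hS s (Multiset.mem_cons_of_mem hs), Multiset.card_cons]
      ring
  have hsplit := IsAlgClosed.splits p
  have hprod := hsplit.eq_prod_roots_of_monic hp
  have key := hroots p.roots fun s hs => h s (Polynomial.isRoot_of_mem_roots hs)
  rw [← hprod, ← hsplit.natDegree_eq_card_roots] at key
  exact key

end Spectrum

/-! ### Decay of signals along stable linear dynamics. -/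

section Decay

variable {E F : Type*} [NormedAddCommGroup E] [NormedSpace ℂ E] [NormedAddCommGroup F]
  [NormedSpace ℂ F]

/-- A stable first-order filter maps a signal vanishing at infinity to such a signal. -/
theorem tendsto_zero_of_hasDerivAt_of_re_neg {c : ℂ} (hc : c.re < 0) {g h : ℝ → E}
    (hg : ∀ t : ℝ, 0 < t → HasDerivAt g (c • g t + h t) t) (hh : Tendsto h atTop (𝓝 0)) :
    Tendsto g atTop (𝓝 0) := by
  set a : ℝ := -c.re with ha
  have ha0 : 0 < a := by linarith
  rw [Metric.tendsto_atTop]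
  intro ε hε
  -- The integrating factor gives `φ' = exp (-c t) • h`, of norm at most `a * (ε / 2) * exp (a t)`,
  -- which integrates to `ε / 2 * exp (a t)`.
  obtain ⟨T₀, hT₀⟩ := Metric.tendsto_atTop.1 hh (a * (ε / 2)) (by positivity)
  set T : ℝ := max T₀ 1 with hT
  have hTpos : 0 < T := lt_of_lt_of_le one_pos (le_max_right _ _)
  set φ : ℝ → E := fun t => Complex.exp (-c * t) • g t with hφ
  have hnexp : ∀ t : ℝ, ‖Complex.exp (-c * t)‖ = Real.exp (a * t) := by
    intro t
    rw [Complex.norm_exp]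
    simp [ha]
  have hderiv : ∀ t : ℝ, 0 < t → HasDerivAt φ (Complex.exp (-c * t) • h t) t := by
    intro t ht
    have h1 : HasDerivAt (fun t : ℝ => Complex.exp (-c * t)) (Complex.exp (-c * t) * (-c)) t := by
      have h0 : HasDerivAt (fun t : ℝ => -c * (t : ℂ)) (-c) t := by
        simpa using (Complex.ofRealCLM.hasDerivAt (x := t)).const_mul (-c)
      exact h0.cexp
    refine (h1.smul (hg t ht)).congr_deriv ?_
    module
  have hbound : ∀ t, T ≤ t → ‖φ t‖ ≤ ‖φ T‖ + ε / 2 * (Real.exp (a * t) - Real.exp (a * T)) := by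
    intro t ht
    have hB : ∀ x : ℝ, HasDerivAt
        (fun x : ℝ => ‖φ T‖ + ε / 2 * (Real.exp (a * x) - Real.exp (a * T)))
        (ε / 2 * (Real.exp (a * x) * a)) x := by
      intro x
      have h0 : HasDerivAt (fun x : ℝ => a * x) a x := by
        simpa using (hasDerivAt_id x).const_mul a
      exact ((h0.exp.sub_const _).const_mul _).const_add _
    refine image_norm_le_of_norm_deriv_right_le_deriv_boundary
      (f' := fun t => Complex.exp (-c * t) • h t)
      (fun x hx => (hderiv x (hTpos.trans_le hx.1)).continuousAt.continuousWithinAt)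
      (fun x hx => (hderiv x (hTpos.trans_le hx.1)).hasDerivWithinAt) (by simp) hB ?_
      (Set.right_mem_Icc.2 ht)
    intro x hx
    have hx' := hT₀ x ((le_max_left _ _).trans hx.1)
    rw [dist_zero_right] at hx'
    rw [norm_smul, hnexp]
    nlinarith [Real.exp_pos (a * x)]
  have hlim : Tendsto (fun t : ℝ => ‖φ T‖ * Real.exp (-(a * t))) atTop (𝓝 0) := by
    have : Tendsto (fun t : ℝ => a * t) atTop atTop := tendsto_id.const_mul_atTop ha0
    simpa using (Real.tendsto_exp_neg_atTop_nhds_zero.comp this).const_mul ‖φ T‖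
  obtain ⟨T₁, hT₁⟩ := Metric.tendsto_atTop.1 hlim (ε / 2) (by positivity)
  refine ⟨max T T₁, fun t ht => ?_⟩
  have h1 := hbound t ((le_max_left _ _).trans ht)
  have h2 := hT₁ t ((le_max_right _ _).trans ht)
  rw [dist_zero_right, Real.norm_of_nonneg (by positivity)] at h2
  rw [dist_zero_right]
  have hge : ‖φ t‖ = Real.exp (a * t) * ‖g t‖ := by rw [hφ]; simp only [norm_smul, hnexp]
  have hmul : Real.exp (-(a * t)) * Real.exp (a * t) = 1 := by rw [← Real.exp_add]; simp
  have hgn : ‖g t‖ = Real.exp (-(a * t)) * ‖φ t‖ := by rw [hge, ← mul_assoc, hmul, one_mul]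
  have hpos := Real.exp_pos (-(a * t))
  calc ‖g t‖ ≤ Real.exp (-(a * t)) *
        (‖φ T‖ + ε / 2 * (Real.exp (a * t) - Real.exp (a * T))) := by
          rw [hgn]; gcongr
    _ = ‖φ T‖ * Real.exp (-(a * t)) + ε / 2 * (Real.exp (-(a * t)) * Real.exp (a * t))
        - ε / 2 * (Real.exp (-(a * t)) * Real.exp (a * T)) := by ring
    _ < ε := by
      rw [hmul]
      have : 0 < ε / 2 * (Real.exp (-(a * t)) * Real.exp (a * T)) := by positivity
      linarith

/-- Along a solution of `x' = f x`, the signal `L x` decays if `L p(f) = 0` for a polynomial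
`p` whose roots lie in the open left half plane. -/
theorem tendsto_zero_of_comp_prod_eq_zero [FiniteDimensional ℂ E] (f : Module.End ℂ E) (x : ℝ → E)
    (hx : ∀ t : ℝ, 0 < t → HasDerivAt x (f (x t)) t) (S : Multiset ℂ) (hS : ∀ s ∈ S, s.re < 0)
    (L : E →ₗ[ℂ] F)
    (hL : L ∘ₗ Polynomial.aeval f (S.map fun a => Polynomial.X - Polynomial.C a).prod = 0) :
    Tendsto (fun t => L (x t)) atTop (𝓝 0) := by
  induction S using Multiset.induction_on generalizing L with
  | empty =>
    have : L = 0 := by simpa [Module.End.one_eq_id] using hL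
    simp [this]
  | cons a S ih =>
    -- Peeling off one root: `(L x)' = a • L x + L (f - a) x`, a stable filter driven by a signal
    -- that decays by induction.
    have h1 := ih (fun s hs => hS s (Multiset.mem_cons_of_mem hs))
      (L ∘ₗ (f - algebraMap ℂ (Module.End ℂ E) a)) (by
        rw [Multiset.map_cons, Multiset.prod_cons, map_mul] at hL
        simpa [LinearMap.comp_assoc, Module.End.mul_eq_comp] using hL)
    refine tendsto_zero_of_hasDerivAt_of_re_neg (hS a (Multiset.mem_cons_self _ _))
      (fun t ht => ?_) h1
    have h2 := ((LinearMap.toContinuousLinearMap L).restrictScalars ℝ).hasFDerivAt.comp_hasDerivAt t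
      (hx t ht)
    refine h2.congr_deriv ?_
    simp [Module.algebraMap_end_apply]

end Decay

theorem LinearMap.aeval_apply_of_intertwines {K V V' : Type*} [CommRing K] [AddCommGroup V]
    [Module K V] [AddCommGroup V'] [Module K V'] {f : Module.End K V} {g : Module.End K V'}
    (L : V →ₗ[K] V') (h : ∀ v, g (L v) = L (f v)) (p : Polynomial K) (v : V) :
    Polynomial.aeval g p (L v) = L (Polynomial.aeval f p v) := by
  induction p using Polynomial.induction_on generalizing v with
  | C a => simp [Module.algebraMap_end_apply]
  | add p q hp hq => simp [hp, hq]
  | monomial n a ih =>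
    rw [pow_succ, ← mul_assoc, map_mul (Polynomial.aeval g), map_mul (Polynomial.aeval f),
      Module.End.mul_apply, Module.End.mul_apply, Polynomial.aeval_X, Polynomial.aeval_X, h, ih]

/-! ### Exponential solutions. -/

section Exponential

variable {E F : Type*} [NormedAddCommGroup E] [NormedSpace ℂ E] [CompleteSpace E]
  [NormedAddCommGroup F] [NormedSpace ℂ F]

theorem ContinuousLinearMap.hasDerivAt_exp_smul_apply (Z : E →L[ℂ] E) (v : E) (t : ℝ) :
    HasDerivAt (fun t : ℝ => NormedSpace.exp ((t : ℂ) • Z) v)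
      (Z (NormedSpace.exp ((t : ℂ) • Z) v)) t := by
  have h1 := hasDerivAt_exp_smul_const' (𝕂 := ℂ) Z (t : ℂ)
  have h2 := (ContinuousLinearMap.apply ℂ E v).hasFDerivAt.comp_hasDerivAt (t : ℂ) h1
  have h3 := h2.scomp t (Complex.ofRealCLM.hasDerivAt (x := t))
  refine h3.congr_deriv ?_
  rw [Complex.ofRealCLM_apply, Complex.ofReal_one, one_smul]
  rfl

/-- Serves vectors that are eigenvectors only modulo a subspace killed by `L`: the exponential
series is summed after applying `L`. -/
theorem ContinuousLinearMap.exp_smul_apply_of_pow_apply {Z : E →L[ℂ] E} {v : E} {s : ℂ}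
    (L : E →L[ℂ] F) (h : ∀ k : ℕ, L ((Z ^ k) v) = s ^ k • L v) (t : ℂ) :
    L (NormedSpace.exp (t • Z) v) = Complex.exp (s * t) • L v := by
  have h1 := NormedSpace.exp_series_hasSum_exp' (𝕂 := ℂ) (t • Z)
  have h2 := h1.mapL (L.comp (ContinuousLinearMap.apply ℂ E v))
  have h3 := (NormedSpace.exp_series_hasSum_exp' (𝕂 := ℂ) (s * t)).smul_const (L v)
  rw [← Complex.exp_eq_exp_ℂ] at h3
  refine h2.unique ?_
  convert h3 using 1
  funext k
  simp only [map_smul, ContinuousLinearMap.comp_apply, ContinuousLinearMap.apply_apply, smul_pow,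
    h, smul_smul, smul_eq_mul]
  congr 1
  ring

end Exponential

/-! ### Zero-output dynamics and left invertibility when `D = 1`. -/

namespace FDLTI

section ZeroOutput

variable {ι κ : Type} [Fintype ι] [DecidableEq ι] [Fintype κ]

/-- The state matrix `A - B C` of the dynamics under the input `u = -C x`, which keeps the output
of a system with identity feedthrough at zero. -/
def zeroOutputMatrix (G : FDLTI ι κ κ) : Matrix ι ι ℂ := G.A - G.B * G.C

omit [Fintype κ] in
theorem mem_unobservable_iff (G : FDLTI ι κ κ) (v : ι → ℂ) :
    v ∈ G.unobservable ↔ ∀ k : ℕ, G.C.mulVec ((G.A ^ k).mulVec v) = 0 := by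
  simp [unobservable, Submodule.mem_iInf]

omit [Fintype κ] in
theorem mulVec_C_eq_zero {G : FDLTI ι κ κ} {v : ι → ℂ} (hv : v ∈ G.unobservable) :
    G.C.mulVec v = 0 := by
  simpa using (G.mem_unobservable_iff v).1 hv 0

omit [DecidableEq ι] in
theorem zeroOutputMatrix_mulVec (G : FDLTI ι κ κ) (v : ι → ℂ) :
    G.zeroOutputMatrix.mulVec v = G.A.mulVec v - G.B.mulVec (G.C.mulVec v) := by
  rw [zeroOutputMatrix, Matrix.sub_mulVec, Matrix.mulVec_mulVec]

theorem zeroOutputMatrix_mulVec_of_mem {G : FDLTI ι κ κ} {v : ι → ℂ} (hv : v ∈ G.unobservable) :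
    G.zeroOutputMatrix.mulVec v = G.A.mulVec v := by
  simp [zeroOutputMatrix_mulVec, mulVec_C_eq_zero hv]

theorem unobservable_invariant_zeroOutput (G : FDLTI ι κ κ) :
    G.unobservable ≤ G.unobservable.comap G.zeroOutputMatrix.mulVecLin := fun v hv => by
  rw [Submodule.mem_comap, Matrix.mulVecLin_apply, zeroOutputMatrix_mulVec_of_mem hv]
  exact G.unobservable_invariant hv

/-- The zero-output dynamics induced on the observable part of the state space. -/
noncomputable def zeroOutputObservablePart (G : FDLTI ι κ κ) :
    Module.End ℂ ((ι → ℂ) ⧸ G.unobservable) :=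
  G.unobservable.mapQ G.unobservable G.zeroOutputMatrix.mulVecLin
    G.unobservable_invariant_zeroOutput

omit [Fintype κ] in
theorem pow_mulVec_sub_smul_mem {W : Submodule ℂ (ι → ℂ)} {M : Matrix ι ι ℂ}
    (hW : W ≤ W.comap M.mulVecLin) {v : ι → ℂ} {s : ℂ} (hv : M.mulVec v - s • v ∈ W) (k : ℕ) :
    (M ^ k).mulVec v - s ^ k • v ∈ W := by
  induction k with
  | zero => simp
  | succ k ih =>
    have h1 : M.mulVec ((M ^ k).mulVec v - s ^ k • v) ∈ W := hW ih
    have h2 := W.add_mem h1 (W.smul_mem (s ^ k) hv)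
    convert h2 using 1
    rw [Matrix.mulVec_sub, Matrix.mulVec_smul, Matrix.mulVec_mulVec, ← pow_succ', smul_sub,
      smul_smul, ← pow_succ]
    abel

/-- If `C v = 0`, the feedback drops out and `A v ≡ s v` modulo the unobservable space. Then `C A^k
v = s^k C v = 0` for all `k`, so `v` is unobservable. -/
theorem C_mulVec_ne_zero_of_eigenvector {G : FDLTI ι κ κ} {v : ι → ℂ} {s : ℂ}
    (hv : v ∉ G.unobservable) (h : G.zeroOutputMatrix.mulVec v - s • v ∈ G.unobservable) :
    G.C.mulVec v ≠ 0 := by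
  intro h0
  refine hv ((G.mem_unobservable_iff v).2 fun k => ?_)
  have hA : G.A.mulVec v - s • v ∈ G.unobservable := by
    simpa [zeroOutputMatrix_mulVec, h0] using h
  have h1 := mulVec_C_eq_zero (pow_mulVec_sub_smul_mem G.unobservable_invariant hA k)
  simpa [Matrix.mulVec_sub, Matrix.mulVec_smul, h0] using h1

omit [DecidableEq ι] in
theorem input_eq_of_output_eq_zero [DecidableEq κ] {G : FDLTI ι κ κ} (hD : G.D = 1)
    {u : ℝ → κ → ℂ} {x : ℝ → ι → ℂ} {t : ℝ} (hy : G.output u x t = 0) :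
    u t = -G.C.mulVec (x t) := by
  rw [output, hD, Matrix.one_mulVec] at hy
  exact eq_neg_of_add_eq_zero_right hy

omit [DecidableEq ι] in
-- The input is only locally integrable, but zero output makes it equal to the continuous `-C x` for
-- positive times, so the integral equation can be differentiated.
theorem IsTrajectory.hasDerivAt_of_output_eq_zero [DecidableEq κ] {G : FDLTI ι κ κ}
    (hD : G.D = 1) {x₀ : ι → ℂ} {u : ℝ → κ → ℂ} {x : ℝ → ι → ℂ} (hx : G.IsTrajectory x₀ u x)
    (hy : ∀ t : ℝ, 0 < t → G.output u x t = 0) (t : ℝ) (ht : 0 < t) :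
    HasDerivAt x (G.zeroOutputMatrix.mulVec (x t)) t := by
  -- Continuity of `x` is known only on `[0, ∞)`; `max s 0` extends it to the whole line.
  have hcont : Continuous fun s : ℝ => G.zeroOutputMatrix.mulVec (x (max s 0)) := by
    have h1 : Continuous fun s : ℝ => x (max s 0) :=
      hx.cont.comp_continuous (by fun_prop) fun s => Set.mem_Ici.2 (le_max_right _ _)
    exact Continuous.matrix_mulVec continuous_const h1
  have heq : ∀ s : ℝ, 0 ≤ s →
      x s = x₀ + ∫ r in (0 : ℝ)..s, G.zeroOutputMatrix.mulVec (x (max r 0)) := by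
    intro s hs
    rw [hx.eq s hs]
    congr 1
    refine intervalIntegral.integral_congr_ae (MeasureTheory.ae_of_all _ fun r hr => ?_)
    -- The half-open interval excludes time `0`, where the output is unconstrained.
    rw [Set.uIoc_of_le hs] at hr
    rw [input_eq_of_output_eq_zero hD (hy r hr.1), max_eq_left hr.1.le,
      zeroOutputMatrix_mulVec, Matrix.mulVec_neg, sub_eq_add_neg]
  have hderiv := (intervalIntegral.integral_hasDerivAt_right (hcont.intervalIntegrable 0 t)
    hcont.stronglyMeasurable.stronglyMeasurableAtFilter hcont.continuousAt).const_add x₀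
  rw [max_eq_left ht.le] at hderiv
  refine hderiv.congr_of_eventuallyEq ?_
  filter_upwards [lt_mem_nhds ht] with s hs using heq s hs.le

/-- The state need not be a pure exponential, as `v` is an eigenvector only modulo the unobservable
space; `C x` is one, because `C` kills the discrepancy. -/
theorem exists_trajectory_output_eq_zero [DecidableEq κ] {G : FDLTI ι κ κ} (hD : G.D = 1)
    {v : ι → ℂ} {s : ℂ} (h : G.zeroOutputMatrix.mulVec v - s • v ∈ G.unobservable) :
    ∃ (u : ℝ → κ → ℂ) (x : ℝ → ι → ℂ), G.IsTrajectory v u x ∧ (∀ t, G.output u x t = 0) ∧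
      ∀ t : ℝ, u t = -Complex.exp (s * t) • G.C.mulVec v := by
  set Z : (ι → ℂ) →L[ℂ] (ι → ℂ) := LinearMap.toContinuousLinearMap G.zeroOutputMatrix.mulVecLin
    with hZ
  have hZapply : ∀ w, Z w = G.zeroOutputMatrix.mulVec w := fun w => rfl
  have hZpow : ∀ (k : ℕ) w, (Z ^ k) w = (G.zeroOutputMatrix ^ k).mulVec w := by
    intro k
    induction k with
    | zero => simp
    | succ k ih =>
      intro w
      rw [show (Z ^ (k + 1)) w = Z ((Z ^ k) w) by rw [pow_succ']; rfl, ih, hZapply,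
        Matrix.mulVec_mulVec, ← pow_succ']
  set x : ℝ → ι → ℂ := fun t => NormedSpace.exp ((t : ℂ) • Z) v with hx
  have hx0 : x 0 = v := by
    simp only [hx, Complex.ofReal_zero]
    rw [zero_smul ℂ Z, NormedSpace.exp_zero]
    rfl
  have hderiv : ∀ t, HasDerivAt x (G.zeroOutputMatrix.mulVec (x t)) t :=
    Z.hasDerivAt_exp_smul_apply v
  have hxcont : Continuous x := continuous_iff_continuousAt.2 fun t => (hderiv t).continuousAt
  have hu : Continuous fun t => -G.C.mulVec (x t) :=
    (Continuous.matrix_mulVec continuous_const hxcont).neg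
  have hCx : ∀ t : ℝ, G.C.mulVec (x t) = Complex.exp (s * t) • G.C.mulVec v := by
    refine fun t => ContinuousLinearMap.exp_smul_apply_of_pow_apply
      (LinearMap.toContinuousLinearMap G.C.mulVecLin) (fun k => ?_) t
    have h4 := mulVec_C_eq_zero
      (pow_mulVec_sub_smul_mem G.unobservable_invariant_zeroOutput h k)
    rw [Matrix.mulVec_sub, Matrix.mulVec_smul, sub_eq_zero] at h4
    rw [hZpow]
    exact h4
  refine ⟨fun t => -G.C.mulVec (x t), x, ⟨fun t _ => hu.intervalIntegrable 0 t,
    hxcont.continuousOn, hx0, fun t _ => ?_⟩, fun t => ?_, fun t => ?_⟩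
  · have h1 : ∀ r, G.A.mulVec (x r) + G.B.mulVec (-G.C.mulVec (x r)) =
        G.zeroOutputMatrix.mulVec (x r) := fun r => by
      rw [zeroOutputMatrix_mulVec, Matrix.mulVec_neg, sub_eq_add_neg]
    simp only [h1]
    rw [intervalIntegral.integral_eq_sub_of_hasDerivAt (fun r _ => hderiv r)
      ((Continuous.matrix_mulVec continuous_const hxcont).intervalIntegrable 0 t)]
    rw [hx0, add_sub_cancel]
  · simp [output, hD]
  · simp [hCx]

theorem isAsymptoticallyStronglyLeftInvertible_iff [DecidableEq κ] {G : FDLTI ι κ κ}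
    (hD : G.D = 1) :
    G.IsAsymptoticallyStronglyLeftInvertible ↔
      ∀ s : ℂ, Module.End.HasEigenvalue G.zeroOutputObservablePart s → s.re < 0 := by
  constructor
  · intro hG s hs
    obtain ⟨w, hw⟩ := hs.exists_hasEigenvector
    obtain ⟨v, rfl⟩ := Submodule.Quotient.mk_surjective _ w
    have hv : v ∉ G.unobservable := fun h => hw.2 ((Submodule.Quotient.mk_eq_zero _).2 h)
    have h : G.zeroOutputMatrix.mulVec v - s • v ∈ G.unobservable :=
      (Submodule.Quotient.eq _).1 hw.apply_eq_smul
    obtain ⟨u, x, htraj, hout, hu⟩ := exists_trajectory_output_eq_zero hD h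
    have hlim := hG v u x htraj fun t _ => hout t
    by_contra! hre
    have hC : 0 < ‖G.C.mulVec v‖ := norm_pos_iff.2 (C_mulVec_ne_zero_of_eigenvector hv h)
    have hge : ∀ᶠ t : ℝ in atTop, ‖G.C.mulVec v‖ ≤ ‖u t‖ := by
      filter_upwards [eventually_ge_atTop 0] with t ht
      rw [hu, norm_smul, norm_neg, Complex.norm_exp]
      refine le_mul_of_one_le_left (norm_nonneg _) (Real.one_le_exp ?_)
      simpa using mul_nonneg hre ht
    have := ge_of_tendsto hlim.norm hge
    simp only [norm_zero] at this
    linarith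
  · intro hs x₀ u x hx hy
    set q := G.zeroOutputObservablePart.charpoly with hq
    have hprod := (IsAlgClosed.splits q).eq_prod_roots_of_monic (LinearMap.charpoly_monic _)
    have h := tendsto_zero_of_comp_prod_eq_zero G.zeroOutputMatrix.mulVecLin x
      (hx.hasDerivAt_of_output_eq_zero hD hy) q.roots
      (fun s h => hs s ((Module.End.hasEigenvalue_iff_isRoot_charpoly _ _).2
        (Polynomial.isRoot_of_mem_roots h))) G.C.mulVecLin (by
        rw [← hprod]
        refine LinearMap.ext fun v => ?_
        -- By Cayley–Hamilton on the quotient, `q` of the zero-output matrix maps every state into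
        -- the unobservable space, where `C` vanishes.
        have h1 := LinearMap.aeval_apply_of_intertwines (f := G.zeroOutputMatrix.mulVecLin)
          (g := G.zeroOutputObservablePart) G.unobservable.mkQ (fun _ => rfl) q v
        have h2 : Polynomial.aeval G.zeroOutputObservablePart q = 0 :=
          LinearMap.aeval_self_charpoly _
        rw [h2, LinearMap.zero_apply, eq_comm,
          Submodule.mkQ_apply, Submodule.Quotient.mk_eq_zero] at h1
        exact mulVec_C_eq_zero h1)
    have h' : Tendsto (fun t => -G.C.mulVec (x t)) atTop (𝓝 0) := by simpa using h.neg
    refine h'.congr' ?_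
    filter_upwards [eventually_gt_atTop 0] with t ht
    exact (input_eq_of_output_eq_zero hD (hy t ht)).symm

end ZeroOutput

end FDLTI

/-- An eigenvector in the unobservable space either is controllable or has nonzero image modulo the
controllable vectors, so its eigenvalue occurs in one of the two blocks. -/
theorem FDLTI.unobservablePart_imaginary {ι κ ο : Type} [Fintype ι] [DecidableEq ι] [Fintype κ]
    {G : FDLTI ι κ ο}
    (h₁ : LinearQuantum.HasImaginarySpectrum G.controllableUnobservablePart)
    (h₂ : LinearQuantum.HasImaginarySpectrum G.uncontrollableUnobservablePart) :
    LinearQuantum.HasImaginarySpectrum G.unobservablePart := by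
  intro s hs
  obtain ⟨v, hv⟩ := hs.exists_hasEigenvector
  have hvs : G.stateMap v = s • (v : ι → ℂ) := congrArg Subtype.val hv.apply_eq_smul
  by_cases hR : (v : ι → ℂ) ∈ G.controllable
  · refine h₁ s (Module.End.hasEigenvalue_of_hasEigenvector (x := ⟨v, hR, v.2⟩)
      ⟨Module.End.mem_eigenspace_iff.2 (Subtype.ext hvs), fun h => hv.2 (Subtype.ext ?_)⟩)
    exact congrArg (fun z : ↥(G.controllable ⊓ G.unobservable) => (z : ι → ℂ)) h
  · refine h₂ s (Module.End.hasEigenvalue_of_hasEigenvector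
      (x := (G.controllable.submoduleOf G.unobservable).mkQ v)
      ⟨Module.End.mem_eigenspace_iff.2 ?_, fun h => hR ?_⟩)
    · rw [← map_smul, ← hv.apply_eq_smul]
      rfl
    · exact (Submodule.Quotient.mk_eq_zero (G.controllable.submoduleOf G.unobservable)).1 h

/-! ### The `♭`-symmetry of linear quantum systems. -/

namespace LinearQuantumSystem

open LinearQuantum

variable {n m : ℕ} (Q : LinearQuantumSystem n m)

theorem J_mul_J (k : ℕ) : J k * J k = 1 := by
  simp [J, Matrix.fromBlocks_multiply]

theorem J_conjTranspose (k : ℕ) : (J k).conjTranspose = J k := by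
  simp [J, Matrix.fromBlocks_conjTranspose]

theorem matD_eq_one : Q.matD = 1 := by
  simp [matD, doubledUp, Matrix.map_one]

/-- Under zero output, a linear quantum system evolves with `-𝒜^♭`. -/
theorem zeroOutputMatrix_eq :
    Q.toFDLTI.zeroOutputMatrix = -flatAdjoint Q.matA := by
  have hΩ : Q.Ω.conjTranspose = Q.Ω := Q.hermitian
  -- As `Ω` is Hermitian, `-i J Ω` is skew for `♭`, while `𝒞^♭ 𝒞` is self-adjoint for it.
  -- Subtracting `ℬ 𝒞 = -𝒞^♭ 𝒞` turns the coefficient `-1/2` into `1/2`.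
  simp only [FDLTI.zeroOutputMatrix, toFDLTI, matA, matB, matD_eq_one, flatAdjoint,
    Matrix.conjTranspose_sub, Matrix.conjTranspose_neg, Matrix.conjTranspose_smul,
    Matrix.conjTranspose_mul, Matrix.conjTranspose_conjTranspose, J_conjTranspose, hΩ,
    Matrix.mul_one, Matrix.mul_sub, Matrix.sub_mul, Matrix.mul_neg, Matrix.neg_mul,
    Matrix.mul_smul, Matrix.smul_mul, Matrix.mul_assoc, J_mul_J]
  simp only [Complex.star_def, map_div₀, map_one, map_ofNat, Complex.conj_I]
  module

/-- Up to multiplication by `J` on both sides, `♭` is the conjugate transpose; since `det J ^ 2 =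
1`, it conjugates determinants. The overall sign comes from the minus in `-𝒜^♭`. -/
theorem charpoly_zeroOutputMatrix :
    Q.toFDLTI.zeroOutputMatrix.charpoly =
      (-1) ^ (Fintype.card (Fin n ⊕ Fin n)) *
        Polynomial.imaginaryReflection Q.matA.charpoly := by
  refine Polynomial.funext fun t => ?_
  have h1 : Matrix.scalar (Fin n ⊕ Fin n) t - Q.toFDLTI.zeroOutputMatrix =
      J n * (-(Matrix.scalar (Fin n ⊕ Fin n) (-star t) - Q.matA)).conjTranspose * J n := by
    have h2 : (Matrix.scalar (Fin n ⊕ Fin n) (-star t)).conjTranspose =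
        -Matrix.scalar (Fin n ⊕ Fin n) t := by
      ext i j
      by_cases h : i = j <;> simp [h, Ne.symm]
    have h3 : J n * Matrix.scalar (Fin n ⊕ Fin n) t * J n = Matrix.scalar (Fin n ⊕ Fin n) t := by
      rw [← (Matrix.scalar_commute t (fun r => mul_comm t r) (J n)).eq, Matrix.mul_assoc, J_mul_J,
        Matrix.mul_one]
    rw [zeroOutputMatrix_eq, Matrix.conjTranspose_neg, Matrix.conjTranspose_sub, h2, flatAdjoint]
    simp only [Matrix.mul_sub, Matrix.sub_mul, Matrix.mul_neg, Matrix.neg_mul, h3]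
    abel
  have hdet : (J n).det * (J n).det = 1 := by rw [← Matrix.det_mul, J_mul_J, Matrix.det_one]
  rw [Matrix.eval_charpoly, h1, Matrix.det_mul, Matrix.det_mul, Matrix.det_conjTranspose,
    Matrix.det_neg, Polynomial.eval_mul, Polynomial.eval_imaginaryReflection,
    Matrix.eval_charpoly, mul_right_comm, hdet, one_mul, star_mul']
  simp

/-- The zero-output dynamics of the observable part has the spectrum of the observable part
reflected in the imaginary axis. -/
theorem hasEigenvalue_zeroOutputObservablePart_iff (hQ : Q.ImaginaryHAndDarkPoles) (s : ℂ) :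
    Module.End.HasEigenvalue Q.toFDLTI.zeroOutputObservablePart s ↔
      Module.End.HasEigenvalue Q.toFDLTI.observablePart (-star s) := by
  set G := Q.toFDLTI with hG
  set r := G.unobservablePart.charpoly with hr
  have hr0 : r.Monic := LinearMap.charpoly_monic _
  have hA : G.A.charpoly = r * G.observablePart.charpoly := by
    rw [← Matrix.charpoly_mulVecLin]
    exact LinearMap.charpoly_eq_charpoly_restrict_mul_charpoly_mapQ _ _ G.unobservable_invariant
  have hZ : G.zeroOutputMatrix.charpoly = r * G.zeroOutputObservablePart.charpoly := by
    rw [← Matrix.charpoly_mulVecLin,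
      LinearMap.charpoly_eq_charpoly_restrict_mul_charpoly_mapQ _ _
        G.unobservable_invariant_zeroOutput]
    -- The feedback vanishes on the unobservable space, so `A` and the zero-output matrix restrict
    -- to the same map and share the factor `r`.
    congr 2
    ext1 v
    exact Subtype.ext (FDLTI.zeroOutputMatrix_mulVec_of_mem v.2)
  have hrefl : Polynomial.imaginaryReflection r = (-1) ^ r.natDegree * r :=
    Polynomial.imaginaryReflection_of_roots_imaginary hr0 fun s hs =>
      FDLTI.unobservablePart_imaginary hQ.h_controllable_unobservable
        hQ.uncontrollable_unobservable s
        ((Module.End.hasEigenvalue_iff_isRoot_charpoly _ _).2 hs)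
  have key : G.zeroOutputObservablePart.charpoly =
      (-1) ^ (Fintype.card (Fin n ⊕ Fin n) + r.natDegree) *
        Polynomial.imaginaryReflection G.observablePart.charpoly := by
    -- Reflecting `r` costs only a sign, so `r` cancels from both sides; the remaining power of `-1`
    -- does not affect the roots.
    refine mul_left_cancel₀ hr0.ne_zero ?_
    have h := Q.charpoly_zeroOutputMatrix
    rw [hZ, show Q.matA = G.A from rfl, hA, map_mul, hrefl] at h
    rw [h]
    ring
  rw [Module.End.hasEigenvalue_iff_isRoot_charpoly, Module.End.hasEigenvalue_iff_isRoot_charpoly,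
    Polynomial.IsRoot, Polynomial.IsRoot, key, Polynomial.eval_mul,
    Polynomial.eval_imaginaryReflection]
  simp

end LinearQuantumSystem

theorem theorem2 (n m : ℕ) (Q : LinearQuantumSystem n m) (hQ : Q.ImaginaryHAndDarkPoles) :
    Q.toFDLTI.IsAsymptoticallyStronglyLeftInvertible ↔
      ∀ s : ℂ, Module.End.HasEigenvalue Q.toFDLTI.observablePart s → 0 < s.re := by
  rw [FDLTI.isAsymptoticallyStronglyLeftInvertible_iff Q.matD_eq_one]
  constructor
  · intro h s hs
    have h1 := h (-star s) ((Q.hasEigenvalue_zeroOutputObservablePart_iff hQ _).2 (by simpa using hs))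
    simpa using h1
  · intro h s hs
    have h1 := h _ ((Q.hasEigenvalue_zeroOutputObservablePart_iff hQ _).1 hs)
    simpa using h1
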